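/- **Theorem 1 (Confidence level of the ENM estimator).** Let $\mathcal{S}$ be the set of density matrices (positive semidefinite, trace one) on $\mathbb{C}^d$. Let $\lambda_1,\dots,\lambda_{d^2-1}$ be Hermitian $d\times d$ matrices with $\operatorname{Tr}\lambda_\alpha=0$ and $\operatorname{Tr}[\lambda_\alpha\lambda_\beta]=2\delta_{\alpha\beta}$. Let $\Pi^{(j)}=\{\Pi^{(j)}_m\}_{m=1}^{M^{(j)}}$, $j=1,\dots,J$, be finitely many POVMs on $\mathbb{C}^d$ (the $\Pi^{(j)}_m$ are positive semidefinite and $\sum_m\Pi^{(j)}_m=I$ for each $j$). Assume that they are informationally complete: the matrices $\Pi^{(j)}_m$ span the real vector space of all Hermitian $d\times d$ matrices. Let $\rho\in\mathcal{S}$ be arbitrary, let $n^{(1)},\dots,n^{(J)}$ be positive integers, $N=\sum_j n^{(j)}$, $r^{(j)}=N/n^{(j)}$, and let $\delta>0$. The measurement $\Pi^{(j)}$ is performed $n^{(j)}$ times on $\rho$. All $N$ trials are independent, and a trial of $\Pi^{(j)}$ has outcome $m$ with probability $\operatorname{Tr}[\Pi^{(j)}_m\rho]$. Let $f_N$ be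 the vector with entries $f^{(j)}_m=n^{(j)}_m/n^{(j)}$, where $n^{(j)}_m$ is the number of trials of $\Pi^{(j)}$ with outcome $m$. For Hermitian $\sigma$ let $p(\sigma)$ be the vector with entries $\operatorname{Tr}[\Pi^{(j)}_m\sigma]$. Define $$\rho^{\mathrm{LLS}}_N=\operatorname*{argmin}_{\sigma=\sigma^\dagger,\ \operatorname{Tr}\sigma=1}\|p(\sigma)-f_N\|_2,\qquad \rho^{\mathrm{ENM}}_N=\operatorname*{argmin}_{\rho'\in\mathcal{S}}\|\rho'-\rho^{\mathrm{LLS}}_N\|_2,$$ with the Euclidean norm on the left and the Hilbert–Schmidt norm on the right. Let $A$ be the real matrix with entries $A_{(j,m),\alpha}=\tfrac12\operatorname{Tr}[\Pi^{(j)}_m\lambda_\alpha]$, let $A_L^{-1}=(A^TA)^{-1}A^T$, and $$c_\alpha=\sum_{j=1}^J r^{(j)}\Big\{\max_m[A_L^{-1}]_{\alpha,(j,m)}-\min_m[A_L^{-1}]_{\alpha,(j,m)}\Big\}^2 .$$ Then all of these objects are well defined: for every data set both minimizers exist and are unique, $A^TA$ is invertible, and $c_\alpha>0$ for all $\alpha$.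 Moreover, with probability at least $$1-2\sum_{\alpha=1}^{d^2-1}\exp\Big[-\frac{b}{c_\alpha}\,\delta^2N\Big]$$ we have $\Delta(\rho^{\mathrm{ENM}}_N,\rho)\le\delta$, for each of the following loss functions $\Delta$ with the corresponding $b$: * Hilbert–Schmidt distance $\Delta(\rho',\rho)=\frac{1}{\sqrt2}\big(\operatorname{Tr}[(\rho'-\rho)^2]\big)^{1/2}$, with $b=\frac{8}{d^2-1}$; * trace distance $\Delta(\rho',\rho)=\frac12\operatorname{Tr}|\rho'-\rho|$, with $b=\frac{16}{d(d^2-1)}$; * infidelity $\Delta(\rho',\rho)=1-\Big(\operatorname{Tr}\sqrt{\sqrt{\rho'}\,\rho\,\sqrt{\rho'}}\Big)^2$, with $b=\frac{4}{d(d^2-1)}$. For $d=1$ the sum over $\alpha$ is empty, the bound is $1$, and $b$ plays no role. -/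

import Mathlib

open scoped ComplexOrder MatrixOrder Matrix
open MeasureTheory

namespace QuantumTomography

noncomputable section

/-- Density matrices on `ℂ ^ d`. -/
def IsState {d : ℕ} (ρ : Matrix (Fin d) (Fin d) ℂ) : Prop :=
  ρ.PosSemidef ∧ ρ.trace = 1

/-- A positive operator-valued measure on `ℂ ^ d` with `M` outcomes. -/
structure POVM (d M : ℕ) where
  /-- the POVM elements -/
  elem : Fin M → Matrix (Fin d) (Fin d) ℂ
  posSemidef : ∀ m, (elem m).PosSemidef
  sum_eq_one : ∑ m, elem m = 1

/-- Born's rule `Tr[Π_m σ]`; the trace is real whenever `σ` is Hermitian. -/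
def POVM.prob {d M : ℕ} (P : POVM d M) (σ : Matrix (Fin d) (Fin d) ℂ) (m : Fin M) : ℝ :=
  ((P.elem m * σ).trace).re

theorem POVM.prob_nonneg {d M : ℕ} (P : POVM d M) {ρ : Matrix (Fin d) (Fin d) ℂ}
    (hρ : IsState ρ) (m : Fin M) : 0 ≤ P.prob ρ m := by
  obtain ⟨B, hB⟩ := CStarAlgebra.nonneg_iff_eq_star_mul_self.mp (P.posSemidef m).nonneg
  have h := (hρ.1.mul_mul_conjTranspose_same B).trace_nonneg
  have e : (P.elem m * ρ).trace = (B * ρ * Bᴴ).trace := by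
    rw [hB, Matrix.star_eq_conjTranspose, Matrix.mul_assoc, Matrix.trace_mul_comm]
  unfold POVM.prob
  rw [e]
  exact (Complex.le_def.mp h).1

theorem POVM.sum_prob {d M : ℕ} (P : POVM d M) {ρ : Matrix (Fin d) (Fin d) ℂ}
    (hρ : IsState ρ) : ∑ m, P.prob ρ m = 1 := by
  unfold POVM.prob
  rw [← Complex.re_sum, ← Matrix.trace_sum, ← Finset.sum_mul, P.sum_eq_one, one_mul, hρ.2]
  rfl

/-- The distribution of the outcome of one measurement of `P` on the state `ρ`. -/
def POVM.outcomePMF {d M : ℕ} (P : POVM d M) {ρ : Matrix (Fin d) (Fin d) ℂ}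
    (hρ : IsState ρ) : PMF (Fin M) :=
  PMF.ofFintype (fun m => ENNReal.ofReal (P.prob ρ m)) (by
    rw [← ENNReal.ofReal_sum_of_nonneg (fun m _ => P.prob_nonneg hρ m), P.sum_prob hρ,
      ENNReal.ofReal_one])

/-- Informational completeness: the POVM elements span, over `ℝ`, the space of all Hermitian
matrices. -/
def InformationallyComplete {d J : ℕ} {M : Fin J → ℕ} (P : (j : Fin J) → POVM d (M j)) : Prop :=
  Submodule.span ℝ (Set.range fun x : (Σ j, Fin (M j)) => (P x.1).elem x.2) =
    selfAdjoint.submodule ℝ (Matrix (Fin d) (Fin d) ℂ)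

/-- Data sets: the outcome of the `q`-th of the `n j` trials of the `j`-th measurement, for
all `j` and `q`. -/
abbrev Data {J : ℕ} (M n : Fin J → ℕ) : Type :=
  (x : Σ j, Fin (n j)) → Fin (M x.1)

/-- The law of the data: all trials are independent, each distributed by Born's rule. -/
def dataMeasure {d J : ℕ} {M : Fin J → ℕ} (P : (j : Fin J) → POVM d (M j)) (n : Fin J → ℕ)
    {ρ : Matrix (Fin d) (Fin d) ℂ} (hρ : IsState ρ) : Measure (Data M n) :=
  Measure.pi fun x : (Σ j, Fin (n j)) => ((P x.1).outcomePMF hρ).toMeasure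

/-- The vector of relative frequencies. -/
def freq {J : ℕ} {M n : Fin J → ℕ} (ω : Data M n) : EuclideanSpace ℝ (Σ j, Fin (M j)) :=
  WithLp.toLp 2 fun x =>
    ((Finset.univ.filter fun q : Fin (n x.1) => ω ⟨x.1, q⟩ = x.2).card : ℝ) / (n x.1 : ℝ)

/-- The vector of all outcome probabilities for the matrix `σ`. -/
def probVec {d J : ℕ} {M : Fin J → ℕ} (P : (j : Fin J) → POVM d (M j))
    (σ : Matrix (Fin d) (Fin d) ℂ) : EuclideanSpace ℝ (Σ j, Fin (M j)) :=
  WithLp.toLp 2 fun x => (P x.1).prob σ x.2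

/-- `σ` is a linear least-squares estimate from the data `ω`. -/
def IsLLSEstimate {d J : ℕ} {M n : Fin J → ℕ} (P : (j : Fin J) → POVM d (M j))
    (ω : Data M n) (σ : Matrix (Fin d) (Fin d) ℂ) : Prop :=
  (σ.IsHermitian ∧ σ.trace = 1) ∧
    IsMinOn (fun τ : Matrix (Fin d) (Fin d) ℂ => ‖probVec P τ - freq ω‖)
      {τ | τ.IsHermitian ∧ τ.trace = 1} σ

/-- The Hilbert-Schmidt norm. -/
def hsNorm {d : ℕ} (X : Matrix (Fin d) (Fin d) ℂ) : ℝ :=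
  Real.sqrt ((Xᴴ * X).trace).re

/-- `σ` is an extended norm-minimization estimate from the data `ω`: a state closest in
Hilbert-Schmidt norm to the linear least-squares estimate. -/
def IsENMEstimate {d J : ℕ} {M n : Fin J → ℕ} (P : (j : Fin J) → POVM d (M j))
    (ω : Data M n) (σ : Matrix (Fin d) (Fin d) ℂ) : Prop :=
  ∃ τ, IsLLSEstimate P ω τ ∧ IsState σ ∧
    IsMinOn (fun σ' : Matrix (Fin d) (Fin d) ℂ => hsNorm (σ' - τ)) {σ' | IsState σ'} σ

/-- The three choices of loss function. -/
inductive Loss where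
  | hilbertSchmidt
  | traceDistance
  | infidelity

/-- The loss functions; `CFC.sqrt` is the square root of a positive semidefinite matrix. -/
def Loss.eval {d : ℕ} : Loss → Matrix (Fin d) (Fin d) ℂ → Matrix (Fin d) (Fin d) ℂ → ℝ
  | .hilbertSchmidt, σ, ρ => 1 / Real.sqrt 2 * Real.sqrt (((σ - ρ) ^ 2).trace).re
  | .traceDistance, σ, ρ => 1 / 2 * ((CFC.sqrt ((σ - ρ)ᴴ * (σ - ρ))).trace).re
  | .infidelity, σ, ρ => 1 - (((CFC.sqrt (CFC.sqrt σ * ρ * CFC.sqrt σ)).trace).re) ^ 2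

/-- The constant `b` attached to a loss function in dimension `d`. -/
def Loss.b (d : ℕ) : Loss → ℝ
  | .hilbertSchmidt => 8 / ((d : ℝ) ^ 2 - 1)
  | .traceDistance => 16 / ((d : ℝ) * ((d : ℝ) ^ 2 - 1))
  | .infidelity => 4 / ((d : ℝ) * ((d : ℝ) ^ 2 - 1))

/-- `d ^ 2 - 1` traceless Hermitian matrices with `Tr[λ_α λ_β] = 2 δ_{αβ}`. -/
structure IsBlochBasis {d : ℕ} (L : Fin (d ^ 2 - 1) → Matrix (Fin d) (Fin d) ℂ) : Prop where
  isHermitian : ∀ α, (L α).IsHermitian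
  traceless : ∀ α, (L α).trace = 0
  orthogonal : ∀ α β, (L α * L β).trace = if α = β then 2 else 0

/-- The matrix `A` with entries `Tr[Π_m^(j) λ_β] / 2`. -/
def designMatrix {d J : ℕ} {M : Fin J → ℕ} (P : (j : Fin J) → POVM d (M j))
    (L : Fin (d ^ 2 - 1) → Matrix (Fin d) (Fin d) ℂ) :
    Matrix (Σ j, Fin (M j)) (Fin (d ^ 2 - 1)) ℝ :=
  Matrix.of fun x β => (((P x.1).elem x.2 * L β).trace).re / 2

/-- The left inverse `(Aᵀ A)⁻¹ Aᵀ`. -/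
def leftInverse {d J : ℕ} {M : Fin J → ℕ} (P : (j : Fin J) → POVM d (M j))
    (L : Fin (d ^ 2 - 1) → Matrix (Fin d) (Fin d) ℂ) :
    Matrix (Fin (d ^ 2 - 1)) (Σ j, Fin (M j)) ℝ :=
  ((designMatrix P L)ᵀ * designMatrix P L)⁻¹ * (designMatrix P L)ᵀ

/-- The constants `c_α`, with weights `r^(j) = N / n^(j)`. -/
def c {d J : ℕ} {M : Fin J → ℕ} (P : (j : Fin J) → POVM d (M j))
    (L : Fin (d ^ 2 - 1) → Matrix (Fin d) (Fin d) ℂ) (n : Fin J → ℕ) (N : ℕ)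
    (α : Fin (d ^ 2 - 1)) : ℝ :=
  ∑ j, ((N : ℝ) / (n j : ℝ)) *
    ((⨆ m : Fin (M j), leftInverse P L α ⟨j, m⟩) -
      ⨅ m : Fin (M j), leftInverse P L α ⟨j, m⟩) ^ 2

end

end QuantumTomography

/-! In Bloch coordinates, σ = 1/d + ½ Σ s_α λ_α, the Hilbert–Schmidt distance is the Euclidean one
divided by √2, and the outcome probabilities are affine in s with linear part A. Informational
completeness makes A injective, so least squares is solved by the normal equations, and the error of
the estimate is A_L⁻¹(f_N − p(ρ)) (`llsBloch_sub`).

Each coordinate of this error is a centred sum of N independent bounded terms, one per trial, whose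
squared ranges add up to c_α / N. Hoeffding's inequality bounds the probability that it reaches ε by
2 exp(−2ε²N / c_α). Projecting onto the convex set of states, which contains ρ, does not increase
the distance to ρ.

With ε² = bδ²/2, outside the d² − 1 bad events the squared Hilbert–Schmidt error is at most (d² −
1)bδ²/4. The constants b come from comparing losses: the trace distance T satisfies T² ≤ (d/4)‖·‖₂²
by Cauchy–Schwarz, and the infidelity is at most 2T by Powers–Størmer. -/

namespace QuantumTomography

noncomputable section

/-! ### Bloch coordinates -/

section BlochParametrization

variable {d : ℕ} {L : Fin (d ^ 2 - 1) → Matrix (Fin d) (Fin d) ℂ}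

theorem IsState.dim_pos {ρ : Matrix (Fin d) (Fin d) ℂ} (hρ : IsState ρ) : 0 < d := by
  rcases Nat.eq_zero_or_pos d with rfl | h
  · simpa [Matrix.trace] using hρ.2
  · exact h

theorem ofReal_re_trace_mul {X Y : Matrix (Fin d) (Fin d) ℂ} (hX : X.IsHermitian)
    (hY : Y.IsHermitian) : (((X * Y).trace.re : ℝ) : ℂ) = (X * Y).trace := by
  rw [← Complex.conj_eq_iff_re, starRingEnd_apply, ← Matrix.trace_conjTranspose,
    Matrix.conjTranspose_mul, hX.eq, hY.eq, Matrix.trace_mul_comm]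

/-- A basis of traceless matrices together with the identity spans all matrices. -/
theorem IsBlochBasis.expansion (hL : IsBlochBasis L) (hd : 0 < d)
    (X : Matrix (Fin d) (Fin d) ℂ) :
    X = (X.trace / d) • (1 : Matrix (Fin d) (Fin d) ℂ) +
      ∑ α, ((X * L α).trace / 2) • L α := by
  have hd' : (d : ℂ) ≠ 0 := by exact_mod_cast hd.ne'
  have htr (a : ℂ) (g : Fin (d ^ 2 - 1) → ℂ) :
      (a • (1 : Matrix (Fin d) (Fin d) ℂ) + ∑ α, g α • L α).trace = a * d := by
    simp [Matrix.trace_add, Matrix.trace_sum, Matrix.trace_smul, hL.traceless]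
  have htrL (a : ℂ) (g : Fin (d ^ 2 - 1) → ℂ) (β) :
      ((a • (1 : Matrix (Fin d) (Fin d) ℂ) + ∑ α, g α • L α) * L β).trace = g β * 2 := by
    simp [add_mul, Finset.sum_mul, Matrix.trace_add, Matrix.trace_sum, Matrix.trace_smul,
      hL.traceless, hL.orthogonal]
  -- Together with the identity there are d² matrices, the dimension of the whole space, so
  -- independence already gives spanning. Taking the trace, alone or against `L β`, isolates each
  -- coefficient.
  let v : Option (Fin (d ^ 2 - 1)) → Matrix (Fin d) (Fin d) ℂ := fun i => i.elim 1 L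
  have hv : LinearIndependent ℂ v := by
    rw [Fintype.linearIndependent_iff]
    intro g hg
    have hg' : g none • (1 : Matrix (Fin d) (Fin d) ℂ) + ∑ α, g (some α) • L α = 0 := by
      rw [Fintype.sum_option] at hg
      exact hg
    rintro (_ | β)
    · have := htr (g none) (fun α => g (some α))
      rw [hg', Matrix.trace_zero] at this
      exact (mul_eq_zero.mp this.symm).resolve_right hd'
    · have := htrL (g none) (fun α => g (some α)) β
      rw [hg', zero_mul, Matrix.trace_zero] at this
      exact (mul_eq_zero.mp this.symm).resolve_right two_ne_zero
  have hspan := hv.span_eq_top_of_card_eq_finrank' (by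
    have : 1 ≤ d ^ 2 := Nat.one_le_pow _ _ hd
    simp only [Fintype.card_option, Fintype.card_fin, Module.finrank_matrix, Module.finrank_self]
    rw [Nat.sub_add_cancel this]
    ring)
  have hX : X ∈ Submodule.span ℂ (Set.range v) := by rw [hspan]; trivial
  obtain ⟨g, hg⟩ := (Submodule.mem_span_range_iff_exists_fun ℂ).mp hX
  have hg' : g none • (1 : Matrix (Fin d) (Fin d) ℂ) + ∑ α, g (some α) • L α = X := by
    rw [Fintype.sum_option] at hg
    exact hg
  have h1 := htr (g none) (fun α => g (some α))
  have h2 := htrL (g none) (fun α => g (some α))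
  rw [hg'] at h1
  simp only [hg'] at h2
  simp only [h1, h2, mul_div_cancel_right₀ _ hd', mul_div_cancel_right₀ _ (two_ne_zero (α := ℂ))]
  exact hg'.symm

/-- The combination of the matrices `λ_α / 2` with real coefficients `s_α`. -/
def blochLinear (L : Fin (d ^ 2 - 1) → Matrix (Fin d) (Fin d) ℂ)
    (s : EuclideanSpace ℝ (Fin (d ^ 2 - 1))) : Matrix (Fin d) (Fin d) ℂ :=
  ∑ α, ((s α / 2 : ℝ) : ℂ) • L α

/-- The Hermitian matrix of trace one with Bloch vector `s`. -/
def bloch (L : Fin (d ^ 2 - 1) → Matrix (Fin d) (Fin d) ℂ)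
    (s : EuclideanSpace ℝ (Fin (d ^ 2 - 1))) : Matrix (Fin d) (Fin d) ℂ :=
  ((d : ℂ)⁻¹) • 1 + blochLinear L s

theorem blochLinear_add (s t : EuclideanSpace ℝ (Fin (d ^ 2 - 1))) :
    blochLinear L (s + t) = blochLinear L s + blochLinear L t := by
  simp [blochLinear, ← Finset.sum_add_distrib, ← add_smul, add_div]

theorem blochLinear_smul (a : ℝ) (s : EuclideanSpace ℝ (Fin (d ^ 2 - 1))) :
    blochLinear L (a • s) = (a : ℂ) • blochLinear L s := by
  simp [blochLinear, Finset.smul_sum, smul_smul, mul_div_assoc]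

theorem bloch_sub (s t : EuclideanSpace ℝ (Fin (d ^ 2 - 1))) :
    bloch L s - bloch L t = blochLinear L (s - t) := by
  have := blochLinear_add (L := L) (s - t) t
  rw [sub_add_cancel] at this
  simp [bloch, this]

theorem IsBlochBasis.isHermitian_blochLinear (hL : IsBlochBasis L)
    (s : EuclideanSpace ℝ (Fin (d ^ 2 - 1))) : (blochLinear L s).IsHermitian := by
  simp only [Matrix.IsHermitian, blochLinear, Matrix.conjTranspose_sum, Matrix.conjTranspose_smul,
    (hL.isHermitian _).eq, Complex.star_def, Complex.conj_ofReal]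

theorem IsBlochBasis.trace_blochLinear (hL : IsBlochBasis L)
    (s : EuclideanSpace ℝ (Fin (d ^ 2 - 1))) : (blochLinear L s).trace = 0 := by
  simp [blochLinear, Matrix.trace_sum, Matrix.trace_smul, hL.traceless]

theorem IsBlochBasis.isHermitian_bloch (hL : IsBlochBasis L)
    (s : EuclideanSpace ℝ (Fin (d ^ 2 - 1))) : (bloch L s).IsHermitian := by
  refine Matrix.IsHermitian.add ?_ (hL.isHermitian_blochLinear s)
  simp [Matrix.IsHermitian, Matrix.conjTranspose_smul]

theorem IsBlochBasis.trace_bloch (hL : IsBlochBasis L) (hd : 0 < d)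
    (s : EuclideanSpace ℝ (Fin (d ^ 2 - 1))) : (bloch L s).trace = 1 := by
  have hd' : (d : ℂ) ≠ 0 := by exact_mod_cast hd.ne'
  simp [bloch, Matrix.trace_add, Matrix.trace_smul, hL.trace_blochLinear, hd']

theorem IsBlochBasis.exists_bloch (hL : IsBlochBasis L) (hd : 0 < d)
    {σ : Matrix (Fin d) (Fin d) ℂ} (hσ : σ.IsHermitian) (htr : σ.trace = 1) :
    ∃ s, bloch L s = σ := by
  refine ⟨WithLp.toLp 2 fun α => (σ * L α).trace.re, ?_⟩
  conv_rhs => rw [hL.expansion hd σ]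
  simp only [bloch, blochLinear, htr, one_div]
  congr 1
  refine Finset.sum_congr rfl fun α _ => ?_
  rw [Complex.ofReal_div, ofReal_re_trace_mul hσ (hL.isHermitian α)]
  rfl

/-- Orthogonality leaves 2 · (s_α / 2)² per coordinate. This is what turns Hilbert–Schmidt geometry
into Euclidean geometry of Bloch vectors. -/
theorem IsBlochBasis.trace_blochLinear_sq (hL : IsBlochBasis L)
    (s : EuclideanSpace ℝ (Fin (d ^ 2 - 1))) :
    (blochLinear L s * blochLinear L s).trace.re = ‖s‖ ^ 2 / 2 := by
  have : (blochLinear L s * blochLinear L s).trace = ((∑ α, s α ^ 2 / 2 : ℝ) : ℂ) := by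
    simp only [blochLinear, Finset.sum_mul, Finset.mul_sum, Matrix.trace_sum, smul_mul_assoc,
      mul_smul_comm, Matrix.trace_smul, hL.orthogonal, smul_eq_mul, mul_ite, mul_zero]
    push_cast
    refine Finset.sum_congr rfl fun α _ => ?_
    simp
    ring
  rw [this, Complex.ofReal_re, EuclideanSpace.norm_sq_eq, Finset.sum_div]
  simp

theorem IsBlochBasis.hsNorm_blochLinear (hL : IsBlochBasis L)
    (s : EuclideanSpace ℝ (Fin (d ^ 2 - 1))) : hsNorm (blochLinear L s) = ‖s‖ / √2 := by
  rw [hsNorm, (hL.isHermitian_blochLinear s).eq, hL.trace_blochLinear_sq, Real.sqrt_div (by positivity),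
    Real.sqrt_sq (norm_nonneg _)]

end BlochParametrization

/-! ### The linear model and its left inverse -/

section LinearModel

variable {d J : ℕ} {M : Fin J → ℕ} {P : (j : Fin J) → POVM d (M j)}
  {L : Fin (d ^ 2 - 1) → Matrix (Fin d) (Fin d) ℂ}

theorem POVM.prob_add {m : ℕ} (Q : POVM d m) (X Y : Matrix (Fin d) (Fin d) ℂ) (k : Fin m) :
    Q.prob (X + Y) k = Q.prob X k + Q.prob Y k := by
  simp [POVM.prob, mul_add, Matrix.trace_add]

theorem designMatrix_mulVec (s : EuclideanSpace ℝ (Fin (d ^ 2 - 1))) (x : Σ j, Fin (M j)) :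
    (designMatrix P L *ᵥ s.ofLp) x = (P x.1).prob (blochLinear L s) x.2 := by
  simp only [Matrix.mulVec, dotProduct, designMatrix, Matrix.of_apply, POVM.prob, blochLinear,
    Finset.mul_sum, Matrix.trace_sum, Complex.re_sum, mul_smul_comm, Matrix.trace_smul]
  refine Finset.sum_congr rfl fun α _ => ?_
  rw [smul_eq_mul, Complex.re_ofReal_mul]
  ring

theorem probVec_bloch (s : EuclideanSpace ℝ (Fin (d ^ 2 - 1))) :
    probVec P (bloch L s) = probVec P (bloch L 0) + WithLp.toLp 2 (designMatrix P L *ᵥ s.ofLp) := by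
  ext x
  have h0 : blochLinear L 0 = 0 := by simp [blochLinear]
  simp only [probVec, PiLp.add_apply, designMatrix_mulVec, ← POVM.prob_add, bloch, h0, add_zero]

/-- Expanding one factor of `X * X` in the POVM elements writes its trace as a combination of the
vanishing probabilities. -/
theorem eq_zero_of_prob_eq_zero (hP : InformationallyComplete P)
    {X : Matrix (Fin d) (Fin d) ℂ} (hX : X.IsHermitian)
    (h : ∀ x : (Σ j, Fin (M j)), (P x.1).prob X x.2 = 0) : ((X * X).trace).re = 0 := by
  have hmem : X ∈ Submodule.span ℝ
      (Set.range fun x : (Σ j, Fin (M j)) => (P x.1).elem x.2) := by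
    rw [hP]
    exact hX
  obtain ⟨g, hg⟩ := (Submodule.mem_span_range_iff_exists_fun ℝ).mp hmem
  have : X * X = ∑ x : (Σ j, Fin (M j)), g x • ((P x.1).elem x.2 * X) := by
    simp only [← smul_mul_assoc, ← Finset.sum_mul, hg]
  rw [this, Matrix.trace_sum, Complex.re_sum]
  refine Finset.sum_eq_zero fun x _ => ?_
  have := h x
  rw [POVM.prob] at this
  rw [Matrix.trace_smul, Complex.smul_re, this, smul_zero]

theorem designMatrix_mulVec_injective (hP : InformationallyComplete P) (hL : IsBlochBasis L) :
    Function.Injective (designMatrix P L).mulVec := by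
  rw [← Matrix.coe_mulVecLin, injective_iff_map_eq_zero]
  intro v hv
  rw [Matrix.mulVecLin_apply] at hv
  have h := eq_zero_of_prob_eq_zero hP (hL.isHermitian_blochLinear (WithLp.toLp 2 v)) fun x => by
    rw [← designMatrix_mulVec]
    exact congrFun hv x
  rw [hL.trace_blochLinear_sq] at h
  have h' : WithLp.toLp 2 v = 0 := by
    rw [← norm_eq_zero]
    exact pow_eq_zero_iff (two_ne_zero) |>.mp (by linarith)
  exact congrArg WithLp.ofLp h'

/-- Since vᵀAᵀAv = ‖Av‖², the kernel of AᵀA is that of A, which is trivial. -/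
theorem isUnit_designMatrix_gram (hP : InformationallyComplete P) (hL : IsBlochBasis L) :
    IsUnit ((designMatrix P L)ᵀ * designMatrix P L) := by
  rw [← Matrix.mulVec_injective_iff_isUnit, ← Matrix.coe_mulVecLin, injective_iff_map_eq_zero]
  intro v hv
  rw [Matrix.mulVecLin_apply, ← Matrix.mulVec_mulVec] at hv
  have h0 : (designMatrix P L *ᵥ v) ⬝ᵥ (designMatrix P L *ᵥ v) = 0 := by
    rw [Matrix.dotProduct_mulVec, ← Matrix.mulVec_transpose, hv, zero_dotProduct]
  exact designMatrix_mulVec_injective hP hL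
    ((dotProduct_self_eq_zero.mp h0).trans (Matrix.mulVec_zero _).symm)

theorem leftInverse_mul_designMatrix (hP : InformationallyComplete P) (hL : IsBlochBasis L) :
    leftInverse P L * designMatrix P L = 1 := by
  rw [leftInverse, Matrix.mul_assoc, Matrix.nonsing_inv_mul _
    ((Matrix.isUnit_iff_isUnit_det _).mp (isUnit_designMatrix_gram hP hL))]

/-- The normal equations: the residual of the fit is orthogonal to the range of A. -/
theorem transpose_mul_leftInverse (hP : InformationallyComplete P) (hL : IsBlochBasis L) :
    (designMatrix P L)ᵀ * (designMatrix P L * leftInverse P L) = (designMatrix P L)ᵀ := by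
  rw [leftInverse, ← Matrix.mul_assoc, ← Matrix.mul_assoc, Matrix.mul_nonsing_inv _
    ((Matrix.isUnit_iff_isUnit_det _).mp (isUnit_designMatrix_gram hP hL)), Matrix.one_mul]

/-- The columns of the design matrix sum to zero over the outcomes of each measurement. -/
theorem sum_designMatrix (hL : IsBlochBasis L) (j : Fin J) (β : Fin (d ^ 2 - 1)) :
    ∑ m, designMatrix P L ⟨j, m⟩ β = 0 := by
  simp only [designMatrix, Matrix.of_apply]
  rw [← Finset.sum_div, ← Complex.re_sum, ← Matrix.trace_sum, ← Finset.sum_mul, (P j).sum_eq_one,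
    one_mul, hL.traceless]
  simp

theorem leftInverse_mem_Icc (α : Fin (d ^ 2 - 1)) (j : Fin J) (m : Fin (M j)) :
    leftInverse P L α ⟨j, m⟩ ∈ Set.Icc (⨅ m : Fin (M j), leftInverse P L α ⟨j, m⟩)
      (⨆ m : Fin (M j), leftInverse P L α ⟨j, m⟩) :=
  ⟨ciInf_le (Set.finite_range fun m => leftInverse P L α ⟨j, m⟩).bddBelow m,
    le_ciSup (Set.finite_range fun m => leftInverse P L α ⟨j, m⟩).bddAbove m⟩

/-- If c_α vanished, row α of the left inverse would be constant on the outcomes of each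
measurement. It would then annihilate A, whose columns sum to zero over those outcomes,
contradicting A_L⁻¹A = 1. -/
theorem c_pos (hP : InformationallyComplete P) (hL : IsBlochBasis L) {n : Fin J → ℕ}
    (hn : ∀ j, 0 < n j) {N : ℕ} (hN : ∑ j, n j = N) (α : Fin (d ^ 2 - 1)) :
    0 < c P L n N α := by
  have hnn : ∀ j ∈ Finset.univ, 0 ≤ ((N : ℝ) / (n j : ℝ)) *
      ((⨆ m : Fin (M j), leftInverse P L α ⟨j, m⟩) -
        ⨅ m : Fin (M j), leftInverse P L α ⟨j, m⟩) ^ 2 := fun j _ => by positivity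
  refine lt_of_le_of_ne (Finset.sum_nonneg hnn) fun h0 => ?_
  have hz := (Finset.sum_eq_zero_iff_of_nonneg hnn).mp h0.symm
  have hconst (j : Fin J) (m : Fin (M j)) :
      leftInverse P L α ⟨j, m⟩ = ⨅ m : Fin (M j), leftInverse P L α ⟨j, m⟩ := by
    have hNpos : 0 < N := hN ▸ (hn j).trans_le
      (Finset.single_le_sum (fun i _ => Nat.zero_le (n i)) (Finset.mem_univ j))
    have hw : (0 : ℝ) < (N : ℝ) / (n j : ℝ) :=
      div_pos (by exact_mod_cast hNpos) (by exact_mod_cast hn j)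
    have := (mul_eq_zero.mp (hz j (Finset.mem_univ j))).resolve_left hw.ne'
    have h2 := pow_eq_zero_iff (two_ne_zero) |>.mp this
    have h3 := leftInverse_mem_Icc (P := P) (L := L) α j m
    exact le_antisymm (h3.2.trans (sub_eq_zero.mp h2).le) h3.1
  have h1 : (leftInverse P L * designMatrix P L) α α = 1 := by
    rw [leftInverse_mul_designMatrix hP hL, Matrix.one_apply_eq]
  rw [Matrix.mul_apply, Fintype.sum_sigma] at h1
  have h2 : ∀ j, ∑ m, leftInverse P L α ⟨j, m⟩ * designMatrix P L ⟨j, m⟩ α = 0 := fun j => by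
    rw [Finset.sum_congr rfl fun m _ => by rw [hconst j m], ← Finset.mul_sum,
      sum_designMatrix hL, mul_zero]
  simp [h2] at h1

end LinearModel

/-! ### The least-squares estimate -/

section Estimators

variable {d J : ℕ} {M n : Fin J → ℕ} {P : (j : Fin J) → POVM d (M j)}
  {L : Fin (d ^ 2 - 1) → Matrix (Fin d) (Fin d) ℂ}

/-- The Bloch vector of the linear least-squares estimate. -/
def llsBloch (P : (j : Fin J) → POVM d (M j))
    (L : Fin (d ^ 2 - 1) → Matrix (Fin d) (Fin d) ℂ) (ω : Data M n) :
    EuclideanSpace ℝ (Fin (d ^ 2 - 1)) :=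
  WithLp.toLp 2 (leftInverse P L *ᵥ (freq ω - probVec P (bloch L 0)).ofLp)

/-- Pythagoras, as the residual at `llsBloch` is orthogonal to the range of A. Existence of the
minimizer can be read off, and uniqueness follows from injectivity of A. -/
theorem norm_probVec_bloch_sub_sq (hP : InformationallyComplete P) (hL : IsBlochBasis L)
    (ω : Data M n) (t : EuclideanSpace ℝ (Fin (d ^ 2 - 1))) :
    ‖probVec P (bloch L t) - freq ω‖ ^ 2 =
      ‖WithLp.toLp 2 (designMatrix P L *ᵥ (t - llsBloch P L ω).ofLp)‖ ^ 2 +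
        ‖probVec P (bloch L (llsBloch P L ω)) - freq ω‖ ^ 2 := by
  have hsplit : probVec P (bloch L t) - freq ω =
      WithLp.toLp 2 (designMatrix P L *ᵥ (t - llsBloch P L ω).ofLp) +
        (probVec P (bloch L (llsBloch P L ω)) - freq ω) := by
    rw [probVec_bloch t, probVec_bloch (llsBloch P L ω), WithLp.ofLp_sub, Matrix.mulVec_sub,
      WithLp.toLp_sub]
    abel
  have hres : (designMatrix P L)ᵀ *ᵥ
      (probVec P (bloch L (llsBloch P L ω)) - freq ω).ofLp = 0 := by
    rw [probVec_bloch, llsBloch, WithLp.ofLp_toLp]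
    have : (probVec P (bloch L 0) + WithLp.toLp 2 (designMatrix P L *ᵥ
        (leftInverse P L *ᵥ (freq ω - probVec P (bloch L 0)).ofLp)) - freq ω).ofLp =
        (designMatrix P L *ᵥ (leftInverse P L *ᵥ (freq ω - probVec P (bloch L 0)).ofLp)) -
          (freq ω - probVec P (bloch L 0)).ofLp := by
      simp only [WithLp.ofLp_sub, WithLp.ofLp_add]
      abel
    rw [this, Matrix.mulVec_sub, Matrix.mulVec_mulVec, Matrix.mulVec_mulVec, Matrix.mul_assoc,
      transpose_mul_leftInverse hP hL, sub_self]
  rw [hsplit]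
  simp only [sq]
  apply norm_add_sq_eq_norm_sq_add_norm_sq_real
  rw [EuclideanSpace.inner_eq_star_dotProduct, star_trivial, dotProduct_comm, WithLp.ofLp_toLp,
    dotProduct_comm, Matrix.dotProduct_mulVec, ← Matrix.mulVec_transpose, hres, zero_dotProduct]

theorem isLLSEstimate_iff (hP : InformationallyComplete P) (hL : IsBlochBasis L) (hd : 0 < d)
    (ω : Data M n) (τ : Matrix (Fin d) (Fin d) ℂ) :
    IsLLSEstimate P ω τ ↔ τ = bloch L (llsBloch P L ω) := by
  constructor
  · rintro ⟨⟨hτ, htr⟩, hmin⟩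
    obtain ⟨t, rfl⟩ := hL.exists_bloch hd hτ htr
    have h1 : ‖probVec P (bloch L t) - freq ω‖ ≤
        ‖probVec P (bloch L (llsBloch P L ω)) - freq ω‖ :=
      hmin ⟨hL.isHermitian_bloch _, hL.trace_bloch hd _⟩
    have h2 := pow_le_pow_left₀ (norm_nonneg _) h1 2
    rw [norm_probVec_bloch_sub_sq hP hL ω t] at h2
    have h3 : ‖WithLp.toLp 2 (designMatrix P L *ᵥ (t - llsBloch P L ω).ofLp)‖ ^ 2 = 0 :=
      le_antisymm (by linarith) (sq_nonneg _)
    have h4 := norm_eq_zero.mp ((pow_eq_zero_iff two_ne_zero).mp h3)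
    have h5 : designMatrix P L *ᵥ (t - llsBloch P L ω).ofLp = 0 := congrArg WithLp.ofLp h4
    have h6 := designMatrix_mulVec_injective hP hL (h5.trans (Matrix.mulVec_zero _).symm)
    have h7 : t - llsBloch P L ω = 0 := congrArg (WithLp.toLp 2) h6
    rw [sub_eq_zero.mp h7]
  · rintro rfl
    refine ⟨⟨hL.isHermitian_bloch _, hL.trace_bloch hd _⟩, ?_⟩
    rintro τ ⟨hτ, htr⟩
    obtain ⟨t, rfl⟩ := hL.exists_bloch hd hτ htr
    refine (pow_le_pow_iff_left₀ (norm_nonneg _) (norm_nonneg _) two_ne_zero).mp ?_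
    rw [norm_probVec_bloch_sub_sq hP hL ω t]
    exact le_add_of_nonneg_left (sq_nonneg _)

end Estimators

/-! ### Projection onto a convex set -/

section Projection

variable {E : Type*} [NormedAddCommGroup E] [InnerProductSpace ℝ E]

/-- The variational inequality ⟪u − v, w − v⟫ ≤ 0, inserted into the expansion of ‖(u − v) − (w −
v)‖². It serves both the uniqueness of the projection and the bound on its distance to points of
`K`. -/
theorem norm_sub_sq_add_le_of_isMinOn {K : Set E} (hK : Convex ℝ K) {u v w : E} (hv : v ∈ K)
    (hmin : ∀ w ∈ K, ‖u - v‖ ≤ ‖u - w‖) (hw : w ∈ K) :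
    ‖v - w‖ ^ 2 + ‖u - v‖ ^ 2 ≤ ‖u - w‖ ^ 2 := by
  have : Nonempty K := ⟨⟨v, hv⟩⟩
  have h := (norm_eq_iInf_iff_real_inner_le_zero hK hv (u := u)).mp
    (le_antisymm (le_ciInf fun w => hmin w w.2)
      (ciInf_le ⟨0, Set.forall_mem_range.2 fun _ => norm_nonneg _⟩ (⟨v, hv⟩ : K))) w hw
  have h2 := norm_sub_sq_real (u - v) (w - v)
  rw [sub_sub_sub_cancel_right, norm_sub_rev w v] at h2
  linarith

end Projection

/-! ### The norm-minimization estimate and its error -/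

section Estimators

variable {d J : ℕ} {M n : Fin J → ℕ} {P : (j : Fin J) → POVM d (M j)}
  {L : Fin (d ^ 2 - 1) → Matrix (Fin d) (Fin d) ℂ}

/-- The set of Bloch vectors of density matrices. -/
def blochBody (L : Fin (d ^ 2 - 1) → Matrix (Fin d) (Fin d) ℂ) :
    Set (EuclideanSpace ℝ (Fin (d ^ 2 - 1))) :=
  {s | IsState (bloch L s)}

theorem convex_blochBody : Convex ℝ (blochBody L) := by
  intro s hs t ht a b ha hb hab
  have hab' : (a : ℂ) + b = 1 := by exact_mod_cast hab
  have h : bloch L (a • s + b • t) = (a : ℂ) • bloch L s + (b : ℂ) • bloch L t := by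
    simp only [bloch, blochLinear_add, blochLinear_smul, smul_add]
    rw [add_add_add_comm, ← add_smul, hab', one_smul]
  have ha' : (0 : ℂ) ≤ a := by exact_mod_cast ha
  have hb' : (0 : ℂ) ≤ b := by exact_mod_cast hb
  refine ⟨h ▸ (hs.1.smul ha').add (ht.1.smul hb'), ?_⟩
  rw [h, Matrix.trace_add, Matrix.trace_smul, Matrix.trace_smul, hs.2, ht.2]
  simpa using hab'

theorem continuous_bloch : Continuous (bloch L) := by
  unfold bloch blochLinear
  fun_prop

theorem isClosed_blochBody : IsClosed (blochBody L) := by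
  have h1 : IsClosed {X : Matrix (Fin d) (Fin d) ℂ | IsState X} := by
    have : {X : Matrix (Fin d) (Fin d) ℂ | IsState X} =
        ({X | Xᴴ = X} ∩ ⋂ x : Fin d → ℂ, {X | 0 ≤ star x ⬝ᵥ (X *ᵥ x)}) ∩ {X | X.trace = 1} := by
      ext X
      simp [IsState, Matrix.posSemidef_iff_dotProduct_mulVec, Matrix.IsHermitian]
    rw [this]
    refine ((isClosed_eq (by fun_prop) (by fun_prop)).inter (isClosed_iInter fun x => ?_)).inter
      (isClosed_eq (by fun_prop) (by fun_prop))
    exact isClosed_le (by fun_prop) (by fun_prop)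
  exact h1.preimage continuous_bloch

/-- The extended norm-minimization estimate exists and is unique. -/
theorem existsUnique_isENMEstimate (hP : InformationallyComplete P) (hL : IsBlochBasis L)
    {ρ : Matrix (Fin d) (Fin d) ℂ} (hρ : IsState ρ) (ω : Data M n) :
    ∃! σ, IsENMEstimate P ω σ := by
  have hd := hρ.dim_pos
  obtain ⟨r, rfl⟩ := hL.exists_bloch hd hρ.1.1 hρ.2
  -- The given state only witnesses that the set to project onto is nonempty.
  obtain ⟨v, hv, hmin⟩ := exists_norm_eq_iInf_of_complete_convex (K := blochBody L) ⟨r, hρ⟩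
    isClosed_blochBody.isComplete convex_blochBody (llsBloch P L ω)
  have hmin' : ∀ w ∈ blochBody L, ‖llsBloch P L ω - v‖ ≤ ‖llsBloch P L ω - w‖ := fun w hw => by
    rw [hmin]
    exact ciInf_le ⟨0, Set.forall_mem_range.2 fun _ => norm_nonneg _⟩ (⟨w, hw⟩ : blochBody L)
  have hs2 : 0 < √(2 : ℝ) := by positivity
  refine ⟨bloch L v, ⟨_, (isLLSEstimate_iff hP hL hd ω _).mpr rfl, hv, ?_⟩, ?_⟩
  · intro σ hσ
    obtain ⟨w, rfl⟩ := hL.exists_bloch hd hσ.1.1 hσ.2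
    change hsNorm _ ≤ hsNorm _
    rw [bloch_sub, bloch_sub, hL.hsNorm_blochLinear, hL.hsNorm_blochLinear, norm_sub_rev,
      norm_sub_rev w]
    exact div_le_div_of_nonneg_right (hmin' w hσ) hs2.le
  · rintro σ ⟨τ, hτ, hσ, hσmin⟩
    obtain ⟨w, rfl⟩ := hL.exists_bloch hd hσ.1.1 hσ.2
    rw [isLLSEstimate_iff hP hL hd] at hτ
    subst hτ
    have h1 : hsNorm (bloch L w - bloch L (llsBloch P L ω)) ≤
      hsNorm (bloch L v - bloch L (llsBloch P L ω)) := hσmin hv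
    rw [bloch_sub, bloch_sub, hL.hsNorm_blochLinear, hL.hsNorm_blochLinear, norm_sub_rev,
      norm_sub_rev v, div_le_div_iff_of_pos_right hs2] at h1
    have h2 := norm_sub_sq_add_le_of_isMinOn convex_blochBody hv hmin' hσ
    have h3 := pow_le_pow_left₀ (norm_nonneg _) h1 2
    have h4 : ‖v - w‖ ^ 2 = 0 := le_antisymm (by linarith) (sq_nonneg _)
    rw [sub_eq_zero.mp (norm_eq_zero.mp ((pow_eq_zero_iff two_ne_zero).mp h4))]

/-- The true Bloch vector lies in the convex body, so the obtuse-angle inequality applies to it. -/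
theorem IsENMEstimate.hsNorm_le (hP : InformationallyComplete P) (hL : IsBlochBasis L)
    {r : EuclideanSpace ℝ (Fin (d ^ 2 - 1))} (hρ : IsState (bloch L r)) {ω : Data M n}
    {σ : Matrix (Fin d) (Fin d) ℂ} (h : IsENMEstimate P ω σ) :
    hsNorm (σ - bloch L r) ≤ ‖llsBloch P L ω - r‖ / √2 := by
  have hd := hρ.dim_pos
  have hs2 : 0 < √(2 : ℝ) := by positivity
  obtain ⟨τ, hτ, hσ, hσmin⟩ := h
  obtain ⟨v, rfl⟩ := hL.exists_bloch hd hσ.1.1 hσ.2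
  rw [isLLSEstimate_iff hP hL hd] at hτ
  subst hτ
  have hmin : ∀ w ∈ blochBody L, ‖llsBloch P L ω - v‖ ≤ ‖llsBloch P L ω - w‖ := fun w hw => by
    have h1 : hsNorm (bloch L v - bloch L (llsBloch P L ω)) ≤
      hsNorm (bloch L w - bloch L (llsBloch P L ω)) := hσmin hw
    rwa [bloch_sub, bloch_sub, hL.hsNorm_blochLinear, hL.hsNorm_blochLinear, norm_sub_rev,
      norm_sub_rev w, div_le_div_iff_of_pos_right hs2] at h1
  have h2 := norm_sub_sq_add_le_of_isMinOn convex_blochBody hσ hmin hρ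
  rw [bloch_sub, hL.hsNorm_blochLinear]
  refine div_le_div_of_nonneg_right (abs_le_of_sq_le_sq' ?_ (norm_nonneg _)).2 hs2.le
  linarith [sq_nonneg ‖llsBloch P L ω - v‖]

/-- Exact probabilities would reproduce `r`, because A_L⁻¹A = 1; the error is therefore linear in
the frequency fluctuations. -/
theorem llsBloch_sub (hP : InformationallyComplete P) (hL : IsBlochBasis L) (ω : Data M n)
    (r : EuclideanSpace ℝ (Fin (d ^ 2 - 1))) (α : Fin (d ^ 2 - 1)) :
    (llsBloch P L ω - r) α =
      ∑ x, leftInverse P L α x * (freq ω x - probVec P (bloch L r) x) := by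
  have h : r.ofLp = leftInverse P L *ᵥ (designMatrix P L *ᵥ r.ofLp) := by
    rw [Matrix.mulVec_mulVec, leftInverse_mul_designMatrix hP hL, Matrix.one_mulVec]
  rw [PiLp.sub_apply, h, llsBloch, ← Pi.sub_apply, ← Matrix.mulVec_sub, Matrix.mulVec, dotProduct]
  refine Finset.sum_congr rfl fun x _ => ?_
  simp only [probVec_bloch r, Pi.sub_apply, PiLp.add_apply, PiLp.sub_apply]
  rw [sub_sub]

end Estimators

/-! ### Trace inequalities -/

section TraceInequalities

variable {d : ℕ}

theorem trace_mul_re_nonneg {A B : Matrix (Fin d) (Fin d) ℂ} (hA : A.PosSemidef)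
    (hB : B.PosSemidef) : 0 ≤ (A * B).trace.re := by
  obtain ⟨C, rfl⟩ := CStarAlgebra.nonneg_iff_eq_star_mul_self.mp hA.nonneg
  rw [Matrix.star_eq_conjTranspose, Matrix.mul_assoc, Matrix.trace_mul_comm]
  exact (Complex.le_def.mp (hB.mul_mul_conjTranspose_same C).trace_nonneg).1

theorem posSemidef_sqrt (A : Matrix (Fin d) (Fin d) ℂ) : (CFC.sqrt A).PosSemidef :=
  Matrix.nonneg_iff_posSemidef.mp (CFC.sqrt_nonneg A)

theorem sqrt_mul_sqrt {A : Matrix (Fin d) (Fin d) ℂ} (hA : A.PosSemidef) :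
    CFC.sqrt A * CFC.sqrt A = A :=
  CFC.sqrt_mul_sqrt_self A hA.nonneg

theorem exists_unitary_diagonal {A : Matrix (Fin d) (Fin d) ℂ} (hA : A.IsHermitian) :
    ∃ V : Matrix (Fin d) (Fin d) ℂ, Vᴴ * V = 1 ∧ V * Vᴴ = 1 ∧
      A = V * Matrix.diagonal (fun i => (hA.eigenvalues i : ℂ)) * Vᴴ := by
  refine ⟨hA.eigenvectorUnitary, ?_, ?_, ?_⟩
  · exact Unitary.coe_star_mul_self hA.eigenvectorUnitary
  · exact Unitary.coe_mul_star_self hA.eigenvectorUnitary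
  · conv_lhs => rw [hA.spectral_theorem, Unitary.conjStarAlgAut_apply]
    rfl

/-- The real part of the trace is bounded by the trace norm. -/
theorem re_trace_le_trace_sqrt (K : Matrix (Fin d) (Fin d) ℂ) :
    K.trace.re ≤ (CFC.sqrt (Kᴴ * K)).trace.re := by
  have hKK := Matrix.posSemidef_conjTranspose_mul_self K
  have hS := posSemidef_sqrt (Kᴴ * K)
  have hSS := sqrt_mul_sqrt hKK
  generalize CFC.sqrt (Kᴴ * K) = S at hS hSS
  obtain ⟨V, hV, hV', hD⟩ := exists_unitary_diagonal hS.1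
  have hμ := hS.eigenvalues_nonneg
  generalize hS.1.eigenvalues = μ at hD hμ
  set D := Matrix.diagonal (fun i => (μ i : ℂ)) with hDdef
  have hcancel (X Y : Matrix (Fin d) (Fin d) ℂ) : V * X * Vᴴ * (V * Y * Vᴴ) = V * (X * Y) * Vᴴ := by
    calc V * X * Vᴴ * (V * Y * Vᴴ) = V * X * (Vᴴ * V) * Y * Vᴴ := by noncomm_ring
      _ = V * (X * Y) * Vᴴ := by rw [hV]; noncomm_ring
  have htr (X : Matrix (Fin d) (Fin d) ℂ) : (V * X * Vᴴ).trace = X.trace := by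
    rw [Matrix.trace_mul_comm, ← Matrix.mul_assoc, hV, Matrix.one_mul]
  -- In the eigenbasis of |K|, the i-th column of K' = VᴴKV has length μ_i, which bounds the
  -- diagonal entry K'_ii.
  have hK : (Vᴴ * K * V)ᴴ * (Vᴴ * K * V) = D * D := by
    calc (Vᴴ * K * V)ᴴ * (Vᴴ * K * V) = Vᴴ * Kᴴ * (V * Vᴴ) * K * V := by
          simp only [Matrix.conjTranspose_mul, Matrix.conjTranspose_conjTranspose]
          noncomm_ring
      _ = Vᴴ * (Kᴴ * K) * V := by rw [hV']; noncomm_ring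
      _ = (Vᴴ * V) * (D * D) * (Vᴴ * V) := by rw [← hSS, hD, hcancel]; noncomm_ring
      _ = D * D := by rw [hV]; noncomm_ring
  have hKtr : (Vᴴ * K * V).trace = K.trace := by
    rw [Matrix.trace_mul_comm, ← Matrix.mul_assoc, hV', Matrix.one_mul]
  rw [hD, htr, ← hKtr]
  generalize Vᴴ * K * V = K' at hK
  simp only [Matrix.trace, Matrix.diag_apply, Complex.re_sum]
  refine Finset.sum_le_sum fun i _ => ?_
  have h1 : ∑ k, Complex.normSq (K' k i) = μ i ^ 2 := by
    have := congrArg Complex.re (congrFun (congrFun hK i) i)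
    rw [Matrix.mul_apply, hDdef, Matrix.diagonal_mul_diagonal, Matrix.diagonal_apply_eq,
      Complex.re_sum, ← Complex.ofReal_mul, Complex.ofReal_re, ← sq] at this
    rw [← this]
    refine Finset.sum_congr rfl fun k _ => ?_
    rw [Matrix.conjTranspose_apply, Complex.star_def, ← Complex.normSq_eq_conj_mul_self,
      Complex.ofReal_re]
  have h2 : Complex.normSq (K' i i) ≤ μ i ^ 2 := by
    rw [← h1]
    exact Finset.single_le_sum (f := fun k => Complex.normSq (K' k i))
      (fun k _ => Complex.normSq_nonneg _) (Finset.mem_univ i)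
  rw [hDdef, Matrix.diagonal_apply_eq, Complex.ofReal_re]
  refine (abs_le_of_sq_le_sq' (le_trans ?_ h2) (hμ i)).2
  rw [Complex.normSq_apply]
  nlinarith [mul_self_nonneg (K' i i).im]

/-- The sign `U` of a Hermitian matrix `X`, so that `U * X` is the absolute value of `X`. -/
theorem exists_sign {X : Matrix (Fin d) (Fin d) ℂ} (hX : X.IsHermitian) :
    ∃ U : Matrix (Fin d) (Fin d) ℂ, Uᴴ * U = 1 ∧ X * U = U * X ∧
      (U * X + X).PosSemidef ∧ (U * X - X).PosSemidef := by
  obtain ⟨V, hV, hV', hD⟩ := exists_unitary_diagonal hX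
  generalize hX.eigenvalues = μ at hD
  -- The value 1 at zero eigenvalues, rather than 0, keeps U unitary.
  let s : Fin d → ℝ := fun i => if 0 ≤ μ i then 1 else -1
  have hcancel (f g : Fin d → ℂ) : V * Matrix.diagonal f * Vᴴ * (V * Matrix.diagonal g * Vᴴ) =
      V * Matrix.diagonal (fun i => f i * g i) * Vᴴ := by
    calc V * Matrix.diagonal f * Vᴴ * (V * Matrix.diagonal g * Vᴴ)
        = V * Matrix.diagonal f * (Vᴴ * V) * Matrix.diagonal g * Vᴴ := by noncomm_ring
      _ = V * (Matrix.diagonal f * Matrix.diagonal g) * Vᴴ := by rw [hV]; noncomm_ring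
      _ = _ := by rw [Matrix.diagonal_mul_diagonal]
  have hpsd (f : Fin d → ℝ) (hf : ∀ i, 0 ≤ f i) :
      (V * Matrix.diagonal (fun i => (f i : ℂ)) * Vᴴ).PosSemidef :=
    (Matrix.PosSemidef.diagonal fun i => Complex.zero_le_real.mpr (hf i)).mul_mul_conjTranspose_same V
  have habs : V * Matrix.diagonal (fun i => (s i : ℂ)) * Vᴴ * X =
      V * Matrix.diagonal (fun i => ((s i * μ i : ℝ) : ℂ)) * Vᴴ := by
    rw [hD, hcancel]
    push_cast
    rfl
  have hs (i) : |μ i| = s i * μ i := by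
    by_cases h : 0 ≤ μ i
    · simp [s, h, abs_of_nonneg]
    · simp [s, h, abs_of_neg (not_le.mp h)]
  refine ⟨V * Matrix.diagonal (fun i => (s i : ℂ)) * Vᴴ, ?_, ?_, ?_, ?_⟩
  · have : (V * Matrix.diagonal (fun i => (s i : ℂ)) * Vᴴ)ᴴ =
        V * Matrix.diagonal (fun i => (s i : ℂ)) * Vᴴ := by
      simp only [Matrix.conjTranspose_mul, Matrix.conjTranspose_conjTranspose,
        Matrix.diagonal_conjTranspose, Matrix.mul_assoc]
      congr 3
      ext i
      simp
    rw [this, hcancel]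
    have h1 : (fun i => (s i : ℂ) * s i) = fun _ => 1 := by
      ext i
      by_cases h : 0 ≤ μ i <;> simp [s, h]
    rw [h1, Matrix.diagonal_one, Matrix.mul_one, hV']
  · rw [habs, hD, hcancel]
    push_cast
    simp only [mul_comm]
  · have : V * Matrix.diagonal (fun i => (s i : ℂ)) * Vᴴ * X + X =
        V * Matrix.diagonal (fun i => ((|μ i| + μ i : ℝ) : ℂ)) * Vᴴ := by
      rw [habs]
      nth_rw 1 [hD]
      rw [← Matrix.add_mul, ← Matrix.mul_add, Matrix.diagonal_add]
      simp only [hs, Complex.ofReal_add]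
    rw [this]
    exact hpsd _ fun i => by linarith [neg_abs_le (μ i)]
  · have : V * Matrix.diagonal (fun i => (s i : ℂ)) * Vᴴ * X - X =
        V * Matrix.diagonal (fun i => ((|μ i| - μ i : ℝ) : ℂ)) * Vᴴ := by
      rw [habs]
      nth_rw 1 [hD]
      rw [← Matrix.sub_mul, ← Matrix.mul_sub, Matrix.diagonal_sub]
      simp only [hs, Complex.ofReal_sub]
    rw [this]
    exact hpsd _ fun i => by linarith [le_abs_self (μ i)]

/-- The **Powers–Størmer inequality**. -/
theorem powers_stormer {A B : Matrix (Fin d) (Fin d) ℂ} (hA : A.PosSemidef) (hB : B.PosSemidef) :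
    ((A - B) * (A - B)).trace.re ≤
      (CFC.sqrt ((A * A - B * B)ᴴ * (A * A - B * B))).trace.re := by
  obtain ⟨U, hU, hcomm, hpos, hneg⟩ := exists_sign (hA.1.sub hB.1)
  have h1 := re_trace_le_trace_sqrt (U * (A * A - B * B))
  have h2 : (U * (A * A - B * B))ᴴ * (U * (A * A - B * B)) =
      (A * A - B * B)ᴴ * (A * A - B * B) := by
    rw [Matrix.conjTranspose_mul, Matrix.mul_assoc, ← Matrix.mul_assoc Uᴴ, hU, Matrix.one_mul]
  rw [h2] at h1
  refine le_trans ?_ h1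
  -- Symmetrize: 2(A² − B²) = (A − B)(A + B) + (A + B)(A − B). After multiplication by U both terms
  -- have the same trace, since U commutes with A − B.
  have h3 : (2 : ℂ) * (U * (A * A - B * B)).trace = 2 * (U * (A - B) * (A + B)).trace := by
    have e : (2 : ℂ) • (U * (A * A - B * B)) =
        U * (A - B) * (A + B) + U * (A + B) * (A - B) := by
      rw [two_smul]; noncomm_ring
    have e2 : (U * (A + B) * (A - B)).trace = (U * (A - B) * (A + B)).trace := by
      rw [Matrix.trace_mul_comm, ← Matrix.mul_assoc, hcomm]
    have e3 := congrArg Matrix.trace e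
    rw [Matrix.trace_smul, Matrix.trace_add, e2, smul_eq_mul] at e3
    rw [e3]; ring
  have h4 : (U * (A * A - B * B)).trace = (U * (A - B) * (A + B)).trace :=
    mul_left_cancel₀ two_ne_zero h3
  -- With |A − B| = U(A − B), the two terms besides (A − B)² are products of positive semidefinite
  -- matrices, so their traces are nonnegative.
  have h5 : U * (A - B) * (A + B) = (A - B) * (A - B) +
      ((U * (A - B) + (A - B)) * B + (U * (A - B) - (A - B)) * A) := by
    noncomm_ring
  rw [h4, h5, Matrix.trace_add, Matrix.trace_add, Complex.add_re, Complex.add_re]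
  linarith [trace_mul_re_nonneg hpos hB, trace_mul_re_nonneg hneg hA]

/-- Cauchy–Schwarz for S = |X| and the identity, in the form Tr (S − a)² ≥ 0 with a = Tr S / d the
mean eigenvalue. -/
theorem trace_sqrt_sq_le (X : Matrix (Fin d) (Fin d) ℂ) :
    (CFC.sqrt (Xᴴ * X)).trace.re ^ 2 ≤ d * (Xᴴ * X).trace.re := by
  rcases Nat.eq_zero_or_pos d with rfl | hd
  · simp [Matrix.trace]
  have hd' : (0 : ℝ) < d := by exact_mod_cast hd
  have hS := posSemidef_sqrt (Xᴴ * X)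
  have hSS := sqrt_mul_sqrt (Matrix.posSemidef_conjTranspose_mul_self X)
  generalize CFC.sqrt (Xᴴ * X) = S at hS hSS
  rw [← hSS]
  set a : ℝ := S.trace.re / d with ha
  have hZ : (S - (a : ℂ) • (1 : Matrix (Fin d) (Fin d) ℂ))ᴴ = S - (a : ℂ) • 1 := by
    simp [Matrix.conjTranspose_sub, Matrix.conjTranspose_smul, hS.1.eq]
  have h := (Complex.le_def.mp (Matrix.posSemidef_conjTranspose_mul_self
    (S - (a : ℂ) • (1 : Matrix (Fin d) (Fin d) ℂ))).trace_nonneg).1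
  have e : (S - (a : ℂ) • (1 : Matrix (Fin d) (Fin d) ℂ)) * (S - (a : ℂ) • 1) =
      S * S - (2 * (a : ℂ)) • S + ((a ^ 2 : ℝ) : ℂ) • 1 := by
    simp only [Matrix.sub_mul, Matrix.mul_sub, Matrix.smul_mul, Matrix.mul_smul, Matrix.one_mul,
      Matrix.mul_one]
    push_cast
    module
  rw [hZ, e] at h
  have e2 : (2 * (a : ℂ)) = ((2 * a : ℝ) : ℂ) := by push_cast; rfl
  rw [e2, Matrix.trace_add, Matrix.trace_sub, Matrix.trace_smul, Matrix.trace_smul,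
    Matrix.trace_one, smul_eq_mul, smul_eq_mul, Complex.add_re, Complex.sub_re,
    Complex.re_ofReal_mul, Complex.re_ofReal_mul, Fintype.card_fin, Complex.natCast_re,
    Complex.zero_re] at h
  have h3 : S.trace.re = a * d := by rw [ha]; field_simp
  rw [h3] at h ⊢
  nlinarith

end TraceInequalities

/-! ### Comparison of the loss functions -/

section Losses

variable {d : ℕ} {σ ρ : Matrix (Fin d) (Fin d) ℂ}

theorem hsNorm_sq (X : Matrix (Fin d) (Fin d) ℂ) : hsNorm X ^ 2 = (Xᴴ * X).trace.re :=
  Real.sq_sqrt (Complex.le_def.mp (Matrix.posSemidef_conjTranspose_mul_self X).trace_nonneg).1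

theorem eval_traceDistance_sq_le :
    Loss.traceDistance.eval σ ρ ^ 2 ≤ d / 4 * hsNorm (σ - ρ) ^ 2 := by
  have := trace_sqrt_sq_le (σ - ρ)
  rw [hsNorm_sq, Loss.eval, mul_pow]
  linarith

/-- One of the **Fuchs–van de Graaf inequalities**, for the squared fidelity. -/
theorem eval_infidelity_le (hσ : IsState σ) (hρ : IsState ρ) :
    Loss.infidelity.eval σ ρ ≤ 2 * Loss.traceDistance.eval σ ρ := by
  have hA := posSemidef_sqrt σ
  have hB := posSemidef_sqrt ρ
  have hAA := sqrt_mul_sqrt hσ.1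
  have hBB := sqrt_mul_sqrt hρ.1
  simp only [Loss.eval]
  generalize CFC.sqrt σ = A at *
  generalize CFC.sqrt ρ = B at *
  -- With A = √σ, B = √ρ and F = Tr|BA| the root fidelity, 2 − 2F ≤ 2 − 2 Tr BA = Tr (A − B)² ≤ Tr|σ
  -- − ρ|. Finally 1 − F² ≤ 2(1 − F).
  have h1 := powers_stormer hA hB
  have h2 := re_trace_le_trace_sqrt (B * A)
  have e : (B * A)ᴴ * (B * A) = A * ρ * A := by
    rw [Matrix.conjTranspose_mul, hA.1.eq, hB.1.eq, ← hBB]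
    noncomm_ring
  rw [e] at h2
  have h3 : ((A - B) * (A - B)).trace.re = 2 - 2 * (B * A).trace.re := by
    have : (A - B) * (A - B) = σ + ρ - A * B - B * A := by
      rw [← hAA, ← hBB]; noncomm_ring
    rw [this, Matrix.trace_sub, Matrix.trace_sub, Matrix.trace_add, hσ.2, hρ.2,
      Matrix.trace_mul_comm A B]
    simp only [Complex.sub_re, Complex.add_re, Complex.one_re]
    ring
  rw [h3, hAA, hBB] at h1
  nlinarith [sq_nonneg ((CFC.sqrt (A * ρ * A)).trace.re - 1)]

/-- A Hilbert–Schmidt ball in which the loss is at most `δ`. -/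
theorem Loss.eval_le (hσ : IsState σ) (hρ : IsState ρ) {δ : ℝ} (hδ : 0 < δ) (Δ : Loss)
    (h : hsNorm (σ - ρ) ^ 2 ≤ ((d : ℝ) ^ 2 - 1) * (Δ.b d / 4) * δ ^ 2) : Δ.eval σ ρ ≤ δ := by
  have hd : (0 : ℝ) < d := by exact_mod_cast hρ.dim_pos
  -- For d = 1 this quotient is 0/0 = 0, otherwise it is 1; the inequality covers both cases.
  have hself := div_self_le_one ((d : ℝ) ^ 2 - 1)
  have hδ2 := sq_nonneg δ
  -- Used with k = 4 for the trace distance, and with k = 1 for the infidelity, which needs trace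
  -- distance at most δ/2.
  have htd (k : ℝ) (hk : 0 ≤ k)
      (h : hsNorm (σ - ρ) ^ 2 ≤ ((d : ℝ) ^ 2 - 1) * (4 * k / (d * ((d : ℝ) ^ 2 - 1)) / 4) * δ ^ 2) :
      Loss.traceDistance.eval σ ρ ^ 2 ≤ k / 4 * δ ^ 2 := by
    refine eval_traceDistance_sq_le.trans ((mul_le_mul_of_nonneg_left h (by positivity)).trans ?_)
    have e : (d : ℝ) / 4 * (((d : ℝ) ^ 2 - 1) * (4 * k / (d * ((d : ℝ) ^ 2 - 1)) / 4) * δ ^ 2) =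
        (((d : ℝ) ^ 2 - 1) / ((d : ℝ) ^ 2 - 1)) * (k / 4 * δ ^ 2) * (d / d) := by
      rw [mul_comm (d : ℝ) ((d : ℝ) ^ 2 - 1), ← div_div]
      ring
    rw [e, div_self hd.ne', mul_one]
    exact mul_le_of_le_one_left (by positivity) hself
  cases Δ with
  | hilbertSchmidt =>
    have e : Loss.hilbertSchmidt.eval σ ρ = hsNorm (σ - ρ) / √2 := by
      rw [Loss.eval, hsNorm, (hσ.1.1.sub hρ.1.1).eq, sq]
      ring
    rw [e, div_le_iff₀ (by positivity)]
    refine (abs_le_of_sq_le_sq' (h.trans ?_) (by positivity)).2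
    rw [mul_pow, Real.sq_sqrt (by norm_num), Loss.b]
    have e : ((d : ℝ) ^ 2 - 1) * (8 / ((d : ℝ) ^ 2 - 1) / 4) * δ ^ 2 =
      (((d : ℝ) ^ 2 - 1) / ((d : ℝ) ^ 2 - 1)) * (δ ^ 2 * 2) := by ring
    rw [e]
    exact mul_le_of_le_one_left (by positivity) hself
  | traceDistance =>
    have := htd 4 (by norm_num) (by rw [Loss.b] at h; norm_num at h ⊢; exact h)
    exact (abs_le_of_sq_le_sq' (by linarith) hδ.le).2
  | infidelity =>
    have := htd 1 (by norm_num) (by rw [Loss.b] at h; norm_num at h ⊢; exact h)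
    have h2 : Loss.traceDistance.eval σ ρ ≤ δ / 2 :=
      (abs_le_of_sq_le_sq' (by nlinarith) (by positivity)).2
    linarith [eval_infidelity_le hσ hρ]

end Losses

/-! ### Hoeffding's inequality -/

section Hoeffding

open ProbabilityTheory

/-- The two-sided **Hoeffding inequality** for a product measure. -/
theorem measureReal_pi_abs_sum_sub_integral_ge_le {ι : Type*} [Fintype ι] {Ω : ι → Type*}
    [∀ i, MeasurableSpace (Ω i)] (μ : (i : ι) → Measure (Ω i)) [∀ i, IsProbabilityMeasure (μ i)]
    {X : (i : ι) → Ω i → ℝ} (hX : ∀ i, Measurable (X i)) {a b : ι → ℝ}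
    (hab : ∀ i ω, X i ω ∈ Set.Icc (a i) (b i)) {ε : ℝ} (hε : 0 ≤ ε) :
    (Measure.pi μ).real {ω | ε ≤ |∑ i, (X i (ω i) - ∫ y, X i y ∂μ i)|} ≤
      2 * Real.exp (-(2 * ε ^ 2 / ∑ i, (b i - a i) ^ 2)) := by
  -- Hoeffding's lemma: a centred variable of range b − a is sub-Gaussian with parameter (b − a)²/4.
  -- Under independence these parameters add.
  have hsub (i : ι) : HasSubgaussianMGF (fun ω : (i : ι) → Ω i => X i (ω i) - ∫ y, X i y ∂μ i)
      ((‖b i - a i‖₊ / 2) ^ 2) (Measure.pi μ) := by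
    refine HasSubgaussianMGF.of_map (X := fun y => X i y - ∫ y, X i y ∂μ i)
      (measurable_pi_apply i).aemeasurable ?_
    rw [(measurePreserving_eval μ i).map_eq]
    exact hasSubgaussianMGF_of_mem_Icc (hX i).aemeasurable (ae_of_all _ (hab i))
  have hind : iIndepFun (fun i (ω : (i : ι) → Ω i) => X i (ω i) - ∫ y, X i y ∂μ i)
      (Measure.pi μ) :=
    iIndepFun_pi (X := fun i y => X i y - ∫ y, X i y ∂μ i)
      fun i => ((hX i).sub_const _).aemeasurable
  have hsum := HasSubgaussianMGF.sum_of_iIndepFun hind (s := Finset.univ) fun i _ => hsub i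
  have hneg := hsum.neg
  have hexp : -ε ^ 2 / (2 * ((∑ i, (‖b i - a i‖₊ / 2) ^ 2 : NNReal) : ℝ)) =
      -(2 * ε ^ 2 / ∑ i, (b i - a i) ^ 2) := by
    have : ((∑ i, (‖b i - a i‖₊ / 2) ^ 2 : NNReal) : ℝ) = (∑ i, (b i - a i) ^ 2) / 4 := by
      push_cast
      rw [Finset.sum_div]
      refine Finset.sum_congr rfl fun i _ => ?_
      rw [div_pow, Real.norm_eq_abs, sq_abs]
      norm_num
    rw [this]
    ring
  have h1 := hsum.measure_ge_le hε
  have h2 := hneg.measure_ge_le hε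
  rw [hexp] at h1 h2
  calc (Measure.pi μ).real {ω | ε ≤ |∑ i, (X i (ω i) - ∫ y, X i y ∂μ i)|}
      ≤ (Measure.pi μ).real ({ω | ε ≤ ∑ i, (X i (ω i) - ∫ y, X i y ∂μ i)} ∪
        {ω | ε ≤ -∑ i, (X i (ω i) - ∫ y, X i y ∂μ i)}) :=
        measureReal_mono fun ω hω => by
          simpa only [Set.mem_union, Set.mem_ofPred_eq, le_abs] using hω
    _ ≤ _ := measureReal_union_le _ _
    _ ≤ _ := add_le_add h1 h2
    _ = _ := (two_mul _).symm

end Hoeffding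

/-! ### Concentration of the least-squares estimate -/

section Confidence

variable {d J : ℕ} {M n : Fin J → ℕ} {P : (j : Fin J) → POVM d (M j)}
  {L : Fin (d ^ 2 - 1) → Matrix (Fin d) (Fin d) ℂ} {ρ : Matrix (Fin d) (Fin d) ℂ}

instance isProbabilityMeasure_dataMeasure (hρ : IsState ρ) :
    IsProbabilityMeasure (dataMeasure P n hρ) := by
  unfold dataMeasure
  infer_instance

theorem integral_outcomePMF {m : ℕ} (Q : POVM d m) (hρ : IsState ρ) (f : Fin m → ℝ) :
    ∫ y, f y ∂(Q.outcomePMF hρ).toMeasure = ∑ y, Q.prob ρ y * f y := by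
  rw [PMF.integral_eq_sum]
  refine Finset.sum_congr rfl fun y _ => ?_
  rw [POVM.outcomePMF, PMF.ofFintype_apply, ENNReal.toReal_ofReal (Q.prob_nonneg hρ y), smul_eq_mul]

/-- A linear functional of the frequency vector is a sum over the individual trials. -/
theorem sum_mul_freq (w : (Σ j, Fin (M j)) → ℝ) (ω : Data M n) :
    ∑ x, w x * freq ω x = ∑ x : (Σ j, Fin (n j)), w ⟨x.1, ω x⟩ / n x.1 := by
  rw [Fintype.sum_sigma, Fintype.sum_sigma]
  refine Finset.sum_congr rfl fun j _ => ?_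
  simp only [freq, Finset.card_filter, Nat.cast_sum, Finset.sum_div, Finset.mul_sum]
  change ∑ m : Fin (M j), ∑ q : Fin (n j),
    w ⟨j, m⟩ * (((if ω ⟨j, q⟩ = m then 1 else 0 : ℕ) : ℝ) / n j) = _
  rw [Finset.sum_comm]
  refine Finset.sum_congr rfl fun q _ => ?_
  rw [Finset.sum_eq_single (ω ⟨j, q⟩)]
  · simp [div_eq_mul_inv]
  · intro m _ hm
    simp [hm.symm]
  · simp

/-- Brings the estimation error into the form required by Hoeffding's inequality: the n^(j) trials
of a measurement have equal means, which add up to its share of the exact value. -/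
theorem sum_mul_freq_sub_probVec (hρ : IsState ρ) (hn : ∀ j, 0 < n j) (w : (Σ j, Fin (M j)) → ℝ)
    (ω : Data M n) :
    ∑ x, w x * (freq ω x - probVec P ρ x) = ∑ x : (Σ j, Fin (n j)), (w ⟨x.1, ω x⟩ / n x.1 -
      ∫ y, w ⟨x.1, y⟩ / n x.1 ∂((P x.1).outcomePMF hρ).toMeasure) := by
  simp only [mul_sub, Finset.sum_sub_distrib, sum_mul_freq]
  congr 1
  rw [Fintype.sum_sigma, Fintype.sum_sigma]
  refine Finset.sum_congr rfl fun j _ => ?_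
  have hj : (n j : ℝ) ≠ 0 := by exact_mod_cast (hn j).ne'
  simp only [integral_outcomePMF, Finset.sum_const, Finset.card_univ, Fintype.card_fin,
    nsmul_eq_mul, Finset.mul_sum, probVec]
  refine Finset.sum_congr rfl fun m _ => ?_
  field_simp

/-- Concentration of each coordinate of the Bloch vector of the linear least-squares estimate. -/
theorem measureReal_abs_llsBloch_sub_ge_le (hP : InformationallyComplete P) (hL : IsBlochBasis L)
    {r : EuclideanSpace ℝ (Fin (d ^ 2 - 1))} (hρ : IsState (bloch L r)) (hn : ∀ j, 0 < n j)
    {N : ℕ} (hN : ∑ j, n j = N) (α : Fin (d ^ 2 - 1)) {ε : ℝ} (hε : 0 ≤ ε) :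
    (dataMeasure P n hρ).real {ω | ε ≤ |(llsBloch P L ω - r) α|} ≤
      2 * Real.exp (-(2 * ε ^ 2 / c P L n N α * N)) := by
  have h := measureReal_pi_abs_sum_sub_integral_ge_le
    (fun x : (Σ j, Fin (n j)) => ((P x.1).outcomePMF hρ).toMeasure)
    (X := fun x y => leftInverse P L α ⟨x.1, y⟩ / n x.1) (fun x => measurable_of_finite _)
    (a := fun x => (⨅ m, leftInverse P L α ⟨x.1, m⟩) / n x.1)
    (b := fun x => (⨆ m, leftInverse P L α ⟨x.1, m⟩) / n x.1)
    (fun x y => ⟨div_le_div_of_nonneg_right (leftInverse_mem_Icc α x.1 y).1 (Nat.cast_nonneg _),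
      div_le_div_of_nonneg_right (leftInverse_mem_Icc α x.1 y).2 (Nat.cast_nonneg _)⟩) hε
  -- There is at least one measurement: otherwise c_α would be an empty sum, although it is
  -- positive.
  have hNpos : (0 : ℝ) < N := by
    have hJ : ∃ j : Fin J, True := by
      by_contra hJ
      push Not at hJ
      have := c_pos hP hL hn hN α
      rw [c, Finset.sum_eq_zero fun j _ => (hJ j).elim] at this
      exact lt_irrefl _ this
    obtain ⟨j, -⟩ := hJ
    exact_mod_cast hN ▸ (hn j).trans_le
      (Finset.single_le_sum (fun i _ => Nat.zero_le (n i)) (Finset.mem_univ j))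
  -- The n^(j) trials each contribute (range / n^(j))², together range² / n^(j) = r^(j) range² / N.
  have hc : ∑ x : (Σ j, Fin (n j)), ((⨆ m, leftInverse P L α ⟨x.1, m⟩) / (n x.1 : ℝ) -
      (⨅ m, leftInverse P L α ⟨x.1, m⟩) / n x.1) ^ 2 = c P L n N α / N := by
    rw [Fintype.sum_sigma, c, Finset.sum_div]
    refine Finset.sum_congr rfl fun j _ => ?_
    have hj : (n j : ℝ) ≠ 0 := by exact_mod_cast (hn j).ne'
    simp only [Finset.sum_const, Finset.card_univ, Fintype.card_fin, nsmul_eq_mul]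
    field_simp
  rw [hc, div_div_eq_mul_div, mul_div_right_comm] at h
  simp only [llsBloch_sub hP hL, sum_mul_freq_sub_probVec hρ hn]
  exact h

end Confidence

end

end QuantumTomography

/-! ### The confidence bound -/

theorem theorem1 {d J : ℕ} {M : Fin J → ℕ}
    (P : (j : Fin J) → QuantumTomography.POVM d (M j))
    (hP : QuantumTomography.InformationallyComplete P)
    (L : Fin (d ^ 2 - 1) → Matrix (Fin d) (Fin d) ℂ)
    (hL : QuantumTomography.IsBlochBasis L)
    (ρ : Matrix (Fin d) (Fin d) ℂ) (hρ : QuantumTomography.IsState ρ)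
    (n : Fin J → ℕ) (hn : ∀ j, 0 < n j) (N : ℕ) (hN : ∑ j, n j = N)
    (δ : ℝ) (hδ : 0 < δ) :
    (∀ ω : QuantumTomography.Data M n, ∃! σ, QuantumTomography.IsLLSEstimate P ω σ) ∧
    (∀ ω : QuantumTomography.Data M n, ∃! σ, QuantumTomography.IsENMEstimate P ω σ) ∧
    IsUnit ((QuantumTomography.designMatrix P L)ᵀ * QuantumTomography.designMatrix P L) ∧
    (∀ α, 0 < QuantumTomography.c P L n N α) ∧
    ∀ ρENM : QuantumTomography.Data M n → Matrix (Fin d) (Fin d) ℂ,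
      (∀ ω, QuantumTomography.IsENMEstimate P ω (ρENM ω)) →
      ∀ Δ : QuantumTomography.Loss,
        1 - 2 * ∑ α, Real.exp (-(Δ.b d / QuantumTomography.c P L n N α) * δ ^ 2 * (N : ℝ)) ≤
          (QuantumTomography.dataMeasure P n hρ).real {ω | Δ.eval (ρENM ω) ρ ≤ δ} := by
  open QuantumTomography in
  have hd := hρ.dim_pos
  refine ⟨fun ω => ⟨_, (isLLSEstimate_iff hP hL hd ω _).mpr rfl,
      fun τ hτ => (isLLSEstimate_iff hP hL hd ω τ).mp hτ⟩,
    fun ω => existsUnique_isENMEstimate hP hL hρ ω, isUnit_designMatrix_gram hP hL,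
    c_pos hP hL hn hN, fun ρENM hENM Δ => ?_⟩
  obtain ⟨r, rfl⟩ := hL.exists_bloch hd hρ.1.1 hρ.2
  have hd1 : (1 : ℝ) ≤ (d : ℝ) ^ 2 := by exact_mod_cast Nat.one_le_pow 2 d hd
  have hb : 0 ≤ Δ.b d := by
    have : (0 : ℝ) ≤ (d : ℝ) ^ 2 - 1 := by linarith
    cases Δ <;> simp only [Loss.b] <;> positivity
  -- Chosen so that the Hoeffding exponent 2ε²/c_α equals bδ²/c_α, while (d² − 1)ε²/2 is exactly the
  -- squared radius allowed by `Loss.eval_le`.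
  set ε := √(Δ.b d / 2) * δ with hεdef
  have hε : 0 ≤ ε := by positivity
  have hε2 : ε ^ 2 = Δ.b d / 2 * δ ^ 2 := by
    rw [hεdef, mul_pow, Real.sq_sqrt (by positivity)]
  -- Covering the whole space, instead of passing to complements, needs only monotonicity and
  -- subadditivity of the measure, hence no measurability of the events.
  have hcover : Set.univ ⊆ {ω | Δ.eval (ρENM ω) (bloch L r) ≤ δ} ∪
      ⋃ α, {ω : Data M n | ε ≤ |(llsBloch P L ω - r) α|} := by
    intro ω _
    by_contra hω
    simp only [Set.mem_union, Set.mem_iUnion, Set.mem_ofPred_eq, not_or, not_exists, not_le] at hω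
    obtain ⟨hω1, hω2⟩ := hω
    refine absurd (Loss.eval_le (hENM ω).choose_spec.2.1 hρ hδ Δ ?_) (not_le.mpr hω1)
    have h1 := (hENM ω).hsNorm_le hP hL hρ
    refine (pow_le_pow_left₀ (Real.sqrt_nonneg _) h1 2).trans ?_
    rw [div_pow, Real.sq_sqrt zero_le_two, EuclideanSpace.norm_sq_eq]
    have h2 : ∑ α, ‖(llsBloch P L ω - r) α‖ ^ 2 ≤ ∑ α : Fin (d ^ 2 - 1), ε ^ 2 :=
      Finset.sum_le_sum fun α _ => pow_le_pow_left₀ (norm_nonneg _) (hω2 α).le 2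
    rw [Finset.sum_const, Finset.card_univ, Fintype.card_fin, nsmul_eq_mul,
      Nat.cast_sub (Nat.one_le_pow 2 d hd), hε2] at h2
    push_cast at h2
    linarith
  have h1 : 1 ≤ (dataMeasure P n hρ).real {ω | Δ.eval (ρENM ω) (bloch L r) ≤ δ} +
      ∑ α, (dataMeasure P n hρ).real {ω | ε ≤ |(llsBloch P L ω - r) α|} := by
    calc (1 : ℝ) = (dataMeasure P n hρ).real Set.univ := by simp
      _ ≤ _ := measureReal_mono hcover
      _ ≤ _ := measureReal_union_le _ _
      _ ≤ _ := by gcongr; exact measureReal_iUnion_fintype_le _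
  have h2 : ∑ α, (dataMeasure P n hρ).real {ω | ε ≤ |(llsBloch P L ω - r) α|} ≤
      2 * ∑ α, Real.exp (-(Δ.b d / c P L n N α) * δ ^ 2 * (N : ℝ)) := by
    rw [Finset.mul_sum]
    refine Finset.sum_le_sum fun α _ => ?_
    refine (measureReal_abs_llsBloch_sub_ge_le hP hL hρ hn hN α hε).trans_eq ?_
    rw [hε2]
    congr 2
    ring
  linarith
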